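/- Let $d\in\mathbb N$, let $|\cdot|$ be the Euclidean norm on $\mathbb R^d$, and let $\mathcal P_2(\mathbb R^d)$ be the set of probability measures on $\mathbb R^d$ with finite second order moment. For probability measures $\eta,\nu$ on $\mathbb R^d$, write $\eta\le_{\mathrm{cx}}\nu$ if $\int\phi\,d\eta\le\int\phi\,d\nu$ for each convex $\phi:\mathbb R^d\to\mathbb R$ such that both integrals make sense in $[-\infty,+\infty]$. For $\mu,\nu\in\mathcal P_2(\mathbb R^d)$, let $\Pi(\mu,\nu)$ be the set of couplings of $\mu$ and $\nu$, let $W_2^2(\mu,\nu)=\inf_{\pi\in\Pi(\mu,\nu)}\int|y-x|^2\,\pi(dx,dy)$, let $\Pi^{opt}(\mu,\nu)$ be the set of the couplings that attain this infimum, and define $$\mathcal I_\mu^\nu=\Big\{\eta\in\mathcal P_2(\mathbb R^d):\ \eta\le_{\mathrm{cx}}\nu\ \text{ and }\ W_2^2(\mu,\nu)=W_2^2(\mu,\eta)+\int|y|^2\,\nu(dy)-\int|z|^2\,\eta(dz)\Big\},$$ $$\tilde{\mathcal I}_\mu^\nu=\Big\{\mathcal T\#\mu:\ k \text{ a Markov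 kernel with } \mu(dx)k(x,dy)\in\Pi^{opt}(\mu,\nu),\ \mathcal T(x)=\int y\,k(x,dy)\Big\}.$$ Let $\mu,\nu\in\mathcal P_2(\mathbb R^d)$. Then: 1. If $\eta\in\mathcal I_\mu^\nu$, then for any probability measure $\tilde\eta$ on $\mathbb R^d$ such that $\eta\le_{\mathrm{cx}}\tilde\eta\le_{\mathrm{cx}}\nu$, one has $\tilde\eta\in\mathcal I_\mu^\nu$ and $\eta\in\mathcal I_\mu^{\tilde\eta}$. 2. $\mathcal I_\mu^\nu=\{\eta\in\mathcal P_2(\mathbb R^d):\ \exists\,\tilde\eta\in\tilde{\mathcal I}_\mu^\nu,\ \tilde\eta\le_{\mathrm{cx}}\eta\le_{\mathrm{cx}}\nu\}$. 3. The set $\mathcal I_\mu^\nu$ is convex. -/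

import Mathlib

open MeasureTheory ProbabilityTheory
open scoped ENNReal NNReal

/-- The Euclidean space `ℝ^d`. -/
abbrev Rd (d : ℕ) : Type := EuclideanSpace ℝ (Fin d)

/-- Probability measures on `ℝ^d` with finite second order moment. -/
def P2 (d : ℕ) : Set (Measure (Rd d)) :=
  {μ | IsProbabilityMeasure μ ∧ ∫⁻ x, ‖x‖ₑ ^ 2 ∂μ < ∞}

/-- The integral of `φ` makes sense in `[-∞, +∞]`: its positive part or its negative part has a
finite integral. -/
def IntegralMakesSense {d : ℕ} (φ : Rd d → ℝ) (μ : Measure (Rd d)) : Prop :=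
  ∫⁻ x, ENNReal.ofReal (φ x) ∂μ ≠ ∞ ∨ ∫⁻ x, ENNReal.ofReal (-φ x) ∂μ ≠ ∞

/-- The integral of `φ` with values in `[-∞, +∞]`, i.e. the integral of the positive part minus
that of the negative part; it is only used when `IntegralMakesSense φ μ`. -/
noncomputable def extIntegral {d : ℕ} (φ : Rd d → ℝ) (μ : Measure (Rd d)) : EReal :=
  ((∫⁻ x, ENNReal.ofReal (φ x) ∂μ : ℝ≥0∞) : EReal)
    - ((∫⁻ x, ENNReal.ofReal (-φ x) ∂μ : ℝ≥0∞) : EReal)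

/-- The convex order: `∫ φ dη ≤ ∫ φ dν` for each convex `φ : ℝ^d → ℝ` such that both integrals
make sense (possibly with infinite values). -/
def ConvexOrder {d : ℕ} (η ν : Measure (Rd d)) : Prop :=
  ∀ φ : Rd d → ℝ, ConvexOn ℝ Set.univ φ →
    IntegralMakesSense φ η → IntegralMakesSense φ ν → extIntegral φ η ≤ extIntegral φ ν

/-- The set of couplings of `μ` and `ν`. -/
def couplings {d : ℕ} (μ ν : Measure (Rd d)) : Set (Measure (Rd d × Rd d)) :=
  {π | π.map Prod.fst = μ ∧ π.map Prod.snd = ν}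

/-- The quadratic transport cost of a measure on `ℝ^d × ℝ^d`. -/
noncomputable def quadCost {d : ℕ} (π : Measure (Rd d × Rd d)) : ℝ≥0∞ :=
  ∫⁻ p, ‖p.2 - p.1‖ₑ ^ 2 ∂π

/-- The squared quadratic Wasserstein distance `W₂²(μ, ν)` (finite on `P2 d`). -/
noncomputable def W2sq {d : ℕ} (μ ν : Measure (Rd d)) : ℝ≥0∞ :=
  ⨅ π ∈ couplings μ ν, quadCost π

/-- The set of optimal couplings of `μ` and `ν`. -/
def optCouplings {d : ℕ} (μ ν : Measure (Rd d)) : Set (Measure (Rd d × Rd d)) :=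
  {π | π ∈ couplings μ ν ∧ quadCost π = W2sq μ ν}

/-- The set `𝓘_μ^ν`: the `η ∈ P2 d` with `η ≤ ν` in the convex order and
`W₂²(μ, ν) = W₂²(μ, η) + ∫ |y|² dν - ∫ |z|² dη`.
All the terms of the equation are finite for `μ, ν ∈ P2 d`. -/
def setI {d : ℕ} (μ ν : Measure (Rd d)) : Set (Measure (Rd d)) :=
  {η | η ∈ P2 d ∧ ConvexOrder η ν ∧
    (W2sq μ ν).toReal = (W2sq μ η).toReal + ∫ y, ‖y‖ ^ 2 ∂ν - ∫ z, ‖z‖ ^ 2 ∂η}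

/-- The barycentre map `x ↦ ∫ y k(x, dy)` of a kernel. -/
noncomputable def barycenterMap {d : ℕ} (k : Kernel (Rd d) (Rd d)) : Rd d → Rd d :=
  fun x => ∫ y, y ∂(k x)

/-- The set `𝓘̃_μ^ν` of the images of `μ` by the barycentre maps of the Markov kernels `k` such
that `μ(dx) k(x, dy)` is an optimal coupling of `μ` and `ν`. -/
def setITilde {d : ℕ} (μ ν : Measure (Rd d)) : Set (Measure (Rd d)) :=
  {θ | ∃ k : Kernel (Rd d) (Rd d), IsMarkovKernel k ∧ μ ⊗ₘ k ∈ optCouplings μ ν ∧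
    θ = μ.map (barycenterMap k)}

open Filter Topology

section QuadraticGrowth

variable {X Y : Type*} [NormedAddCommGroup X] [NormedAddCommGroup Y]

/-- Continuous real functions of at most quadratic growth. -/
def quadGrowth (X : Type*) [NormedAddCommGroup X] : Submodule ℝ (X → ℝ) where
  carrier := {f | Continuous f ∧ ∃ C, ∀ x, |f x| ≤ C * (1 + ‖x‖ ^ 2)}
  zero_mem' := ⟨continuous_zero, 0, fun x => by simp⟩
  add_mem' := by
    rintro f g ⟨hf, C, hC⟩ ⟨hg, D, hD⟩
    refine ⟨hf.add hg, C + D, fun x => ?_⟩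
    calc |f x + g x| ≤ |f x| + |g x| := abs_add_le _ _
      _ ≤ _ := by linarith [hC x, hD x]
  smul_mem' := by
    rintro c f ⟨hf, C, hC⟩
    refine ⟨hf.const_smul c, |c| * C, fun x => ?_⟩
    simp only [Pi.smul_apply, smul_eq_mul, abs_mul, mul_assoc]
    exact mul_le_mul_of_nonneg_left (hC x) (abs_nonneg c)

lemma mem_quadGrowth_of_abs_le {f g : X → ℝ} (hf : Continuous f) (hg : g ∈ quadGrowth X)
    (h : ∀ x, |f x| ≤ g x) : f ∈ quadGrowth X := by
  obtain ⟨_, C, hC⟩ := hg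
  exact ⟨hf, C, fun x => (h x).trans ((le_abs_self _).trans (hC x))⟩

variable (X) in
lemma one_add_norm_sq_mem_quadGrowth : (fun x : X => 1 + ‖x‖ ^ 2) ∈ quadGrowth X :=
  ⟨by fun_prop, 1, fun x => by rw [abs_of_nonneg (by positivity), one_mul]⟩

lemma quadGrowth_comp_fst {g : X → ℝ} (hg : g ∈ quadGrowth X) :
    (fun p : X × Y => g p.1) ∈ quadGrowth (X × Y) := by
  obtain ⟨hc, C, hC⟩ := hg
  have hC0 : 0 ≤ C := by simpa using (abs_nonneg _).trans (hC 0)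
  refine ⟨hc.comp continuous_fst, C, fun p => (hC p.1).trans ?_⟩
  gcongr
  exact norm_fst_le p

lemma quadGrowth_comp_snd {h : Y → ℝ} (hh : h ∈ quadGrowth Y) :
    (fun p : X × Y => h p.2) ∈ quadGrowth (X × Y) := by
  obtain ⟨hc, C, hC⟩ := hh
  have hC0 : 0 ≤ C := by simpa using (abs_nonneg _).trans (hC 0)
  refine ⟨hc.comp continuous_snd, C, fun p => (hC p.2).trans ?_⟩
  gcongr
  exact norm_snd_le p

lemma integrable_of_mem_quadGrowth [MeasurableSpace X] [OpensMeasurableSpace X]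
    {μ : Measure X} [IsFiniteMeasure μ] (hμ : Integrable (fun x => ‖x‖ ^ 2) μ)
    {f : X → ℝ} (hf : f ∈ quadGrowth X) : Integrable f μ := by
  obtain ⟨hc, C, hC⟩ := hf
  exact (((integrable_const 1).add hμ).const_mul C).mono' hc.measurable.aestronglyMeasurable
    (ae_of_all _ hC)

/-- A continuous function with values in `[0, 1]`, equal to one on the ball of radius `n` and
vanishing outside that of radius `n + 1`. -/
noncomputable def ballCutoff (n : ℕ) (x : X) : ℝ := max 0 (min 1 (n + 1 - ‖x‖))

lemma continuous_ballCutoff (n : ℕ) : Continuous (ballCutoff n : X → ℝ) := by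
  unfold ballCutoff; fun_prop

lemma ballCutoff_nonneg (n : ℕ) (x : X) : 0 ≤ ballCutoff n x := le_max_left _ _

lemma ballCutoff_le_one (n : ℕ) (x : X) : ballCutoff n x ≤ 1 :=
  max_le zero_le_one (min_le_left _ _)

lemma ballCutoff_mono (x : X) : Monotone (fun n => ballCutoff n x) := by
  intro m n h
  have : (m : ℝ) ≤ n := by exact_mod_cast h
  exact max_le_max le_rfl (min_le_min le_rfl (by linarith))

lemma ballCutoff_eq_one {n : ℕ} {x : X} (h : ‖x‖ ≤ n) : ballCutoff n x = 1 := by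
  unfold ballCutoff
  rw [min_eq_left (by linarith), max_eq_right zero_le_one]

lemma eventually_ballCutoff_eq_one (x : X) : ∀ᶠ n in atTop, ballCutoff n x = 1 := by
  obtain ⟨N, hN⟩ := exists_nat_ge ‖x‖
  filter_upwards [eventually_ge_atTop N] with n hn
  exact ballCutoff_eq_one (hN.trans (by exact_mod_cast hn))

lemma hasCompactSupport_ballCutoff [ProperSpace X] (n : ℕ) :
    HasCompactSupport (ballCutoff n : X → ℝ) := by
  refine HasCompactSupport.intro (isCompact_closedBall 0 ((n : ℝ) + 1)) fun x hx => ?_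
  have : (n : ℝ) + 1 < ‖x‖ := by simpa using hx
  unfold ballCutoff
  rw [max_eq_left]
  exact (min_le_right _ _).trans (by linarith)

lemma quadTail_mem_quadGrowth (X : Type*) [NormedAddCommGroup X] (n : ℕ) :
    (fun x : X => (1 + ‖x‖ ^ 2) * (1 - ballCutoff n x)) ∈ quadGrowth X := by
  refine mem_quadGrowth_of_abs_le ?_ (one_add_norm_sq_mem_quadGrowth X) fun x => ?_
  · have := continuous_ballCutoff (X := X) n
    fun_prop
  · have h1 := ballCutoff_nonneg n x
    have h2 := ballCutoff_le_one n x
    rw [abs_of_nonneg (mul_nonneg (by positivity) (by linarith))]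
    exact mul_le_of_le_one_right (by positivity) (by linarith)

/-- The weight `1 + ‖x‖ ^ 2` cut off inside of a large ball. -/
noncomputable def quadTail (X : Type*) [NormedAddCommGroup X] (n : ℕ) : quadGrowth X :=
  ⟨fun x => (1 + ‖x‖ ^ 2) * (1 - ballCutoff n x), quadTail_mem_quadGrowth X n⟩

lemma quadTail_nonneg (n : ℕ) (x : X) : 0 ≤ (quadTail X n : X → ℝ) x :=
  mul_nonneg (by positivity) (sub_nonneg.2 (ballCutoff_le_one n x))

lemma quadTail_prod_le (n : ℕ) (p : X × Y) :
    (quadTail (X × Y) n : X × Y → ℝ) p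
      ≤ (quadTail X n : X → ℝ) p.1 + (quadTail Y n : Y → ℝ) p.2 := by
  rcases max_choice ‖p.1‖ ‖p.2‖ with h | h <;> rw [← Prod.norm_def] at h
  · refine le_trans (le_of_eq ?_) (le_add_of_nonneg_right (quadTail_nonneg n p.2))
    simp only [quadTail, ballCutoff, h]
  · refine le_trans (le_of_eq ?_) (le_add_of_nonneg_left (quadTail_nonneg n p.1))
    simp only [quadTail, ballCutoff, h]

lemma tendsto_integral_quadTail [MeasurableSpace X] [OpensMeasurableSpace X]
    {μ : Measure X} [IsFiniteMeasure μ] (hμ : Integrable (fun x => ‖x‖ ^ 2) μ) :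
    Tendsto (fun n => ∫ x, (quadTail X n : X → ℝ) x ∂μ) atTop (𝓝 0) := by
  rw [← integral_zero X ℝ (μ := μ)]
  refine tendsto_integral_of_dominated_convergence (fun x => 1 + ‖x‖ ^ 2)
    (fun n => (quadTail X n).2.1.measurable.aestronglyMeasurable) ((integrable_const 1).add hμ)
    (fun n => ae_of_all _ fun x => ?_) (ae_of_all _ fun x => ?_)
  · rw [Real.norm_of_nonneg (quadTail_nonneg n x)]
    exact mul_le_of_le_one_right (by positivity) (by linarith [ballCutoff_nonneg n x])
  · refine tendsto_const_nhds.congr' ?_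
    filter_upwards [eventually_ballCutoff_eq_one x] with n hn
    simp [quadTail, hn]

open scoped CompactlySupported in
lemma compactlySupported_mem_quadGrowth (f : C_c(X, ℝ)) : (f : X → ℝ) ∈ quadGrowth X := by
  obtain ⟨C, hC⟩ := f.hasCompactSupport.exists_bound_of_continuous f.continuous
  have hC0 : 0 ≤ C := (norm_nonneg _).trans (hC 0)
  refine ⟨f.continuous, C, fun x => (hC x).trans ?_⟩
  nlinarith [sq_nonneg ‖x‖]

open scoped CompactlySupported in
/-- The inclusion of the compactly supported functions into those of quadratic growth. -/
def compactlySupportedToQuadGrowth (X : Type*) [NormedAddCommGroup X] :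
    C_c(X, ℝ) →ₗ[ℝ] quadGrowth X where
  toFun f := ⟨f, compactlySupported_mem_quadGrowth f⟩
  map_add' _ _ := rfl
  map_smul' _ _ := rfl

end QuadraticGrowth

section Representation

variable {Z : Type*} [NormedAddCommGroup Z] [ProperSpace Z] [MeasurableSpace Z] [BorelSpace Z]

open scoped CompactlySupported

/-- A positive linear functional on the functions of quadratic growth which has no mass at
infinity is the integral against a measure. -/
theorem exists_measure_of_positive (L : quadGrowth Z →ₗ[ℝ] ℝ)
    (hL : ∀ F : quadGrowth Z, (∀ z, 0 ≤ (F : Z → ℝ) z) → 0 ≤ L F)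
    (htail : Tendsto (fun n => L (quadTail Z n)) atTop (𝓝 0)) :
    ∃ π : Measure Z, ∀ F : quadGrowth Z, Integrable (F : Z → ℝ) π ∧ ∫ z, (F : Z → ℝ) z ∂π = L F := by
  have hmono : ∀ F G : quadGrowth Z, (∀ z, (F : Z → ℝ) z ≤ (G : Z → ℝ) z) → L F ≤ L G := by
    intro F G h
    have := hL (G - F) fun z => by simpa using h z
    rw [map_sub] at this
    linarith
  let Λ : C_c(Z, ℝ) →ₚ[ℝ] ℝ := PositiveLinearMap.mk₀ (L ∘ₗ compactlySupportedToQuadGrowth Z)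
    fun f hf => hL _ fun z => hf z
  have hΛ (f : C_c(Z, ℝ)) : ∫ z, f z ∂(RealRMK.rieszMeasure Λ)
      = L ⟨f, compactlySupported_mem_quadGrowth f⟩ := RealRMK.integral_rieszMeasure Λ f
  set π := RealRMK.rieszMeasure Λ
  have hpos : ∀ F : quadGrowth Z, (∀ z, 0 ≤ (F : Z → ℝ) z) →
      Integrable (F : Z → ℝ) π ∧ ∫ z, (F : Z → ℝ) z ∂π = L F := by
    intro F hF
    obtain ⟨hFc, C, hC⟩ := F.2
    let f (n : ℕ) : C_c(Z, ℝ) := ⟨⟨fun z => (F : Z → ℝ) z * ballCutoff n z,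
      hFc.mul (continuous_ballCutoff n)⟩, (hasCompactSupport_ballCutoff n).mul_left⟩
    have hf (n z) : f n z = (F : Z → ℝ) z * ballCutoff n z := rfl
    have hf0 (n z) : 0 ≤ f n z := mul_nonneg (hF z) (ballCutoff_nonneg n z)
    have hfint (n) : Integrable (f n) π :=
      (f n).continuous.integrable_of_hasCompactSupport (f n).hasCompactSupport
    have hfle (n z) : f n z ≤ (F : Z → ℝ) z := mul_le_of_le_one_right (hF z) (ballCutoff_le_one n z)
    have hfmono (z) : Monotone (fun n => f n z) := fun m n h =>
      mul_le_mul_of_nonneg_left (ballCutoff_mono z h) (hF z)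
    have hflim (z) : Tendsto (fun n => f n z) atTop (𝓝 ((F : Z → ℝ) z)) := by
      refine tendsto_const_nhds.congr' ?_
      filter_upwards [eventually_ballCutoff_eq_one z] with n hn
      simp [hf, hn]
    have hlint : ∫⁻ z, ENNReal.ofReal ((F : Z → ℝ) z) ∂π ≤ ENNReal.ofReal (L F) := by
      have h1 := lintegral_tendsto_of_tendsto_of_monotone (μ := π)
        (f := fun n z => ENNReal.ofReal (f n z)) (F := fun z => ENNReal.ofReal ((F : Z → ℝ) z))
        (fun n => (f n).continuous.measurable.ennreal_ofReal.aemeasurable)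
        (ae_of_all _ fun z m n h => ENNReal.ofReal_le_ofReal (hfmono z h))
        (ae_of_all _ fun z => (ENNReal.continuous_ofReal.tendsto _).comp (hflim z))
      refine le_of_tendsto' h1 fun n => ?_
      rw [← ofReal_integral_eq_lintegral_ofReal (hfint n) (ae_of_all _ (hf0 n)), hΛ]
      exact ENNReal.ofReal_le_ofReal (hmono _ _ (hfle n))
    have hFint : Integrable (F : Z → ℝ) π := by
      refine ⟨hFc.measurable.aestronglyMeasurable, ?_⟩
      rw [hasFiniteIntegral_iff_ofReal (ae_of_all _ hF)]
      exact hlint.trans_lt ENNReal.ofReal_lt_top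
    refine ⟨hFint, ?_⟩
    have hlim1 : Tendsto (fun n => ∫ z, f n z ∂π) atTop (𝓝 (∫ z, (F : Z → ℝ) z ∂π)) :=
      integral_tendsto_of_tendsto_of_monotone hfint hFint (ae_of_all _ hfmono) (ae_of_all _ hflim)
    have hlim2 : Tendsto (fun n => ∫ z, f n z ∂π) atTop (𝓝 (L F)) := by
      have hlow : Tendsto (fun n => L F - C * L (quadTail Z n)) atTop (𝓝 (L F)) := by
        simpa using tendsto_const_nhds.sub (htail.const_mul C)
      refine tendsto_of_tendsto_of_tendsto_of_le_of_le hlow tendsto_const_nhds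
        (fun n => ?_) (fun n => ?_)
      · have := hmono (F - C • quadTail Z n) ⟨f n, compactlySupported_mem_quadGrowth (f n)⟩
          fun z => by
            have h1 := (le_abs_self _).trans (hC z)
            have h2 := ballCutoff_le_one n z
            have h3 := mul_le_mul_of_nonneg_right h1 (sub_nonneg.2 h2)
            simp only [quadTail, Submodule.coe_sub, Submodule.coe_smul, Pi.sub_apply,
              Pi.smul_apply, smul_eq_mul, hf]
            linarith
        simpa [hΛ] using this
      · dsimp only
        rw [hΛ]
        exact hmono _ _ (hfle n)
    exact tendsto_nhds_unique hlim1 hlim2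
  refine ⟨π, fun F => ?_⟩
  obtain ⟨hFc, C, hC⟩ := F.2
  let W : quadGrowth Z := C • ⟨_, one_add_norm_sq_mem_quadGrowth Z⟩
  have hW (z) : (W : Z → ℝ) z = C * (1 + ‖z‖ ^ 2) := rfl
  obtain ⟨h1, h2⟩ := hpos W fun z => (abs_nonneg _).trans (hC z)
  obtain ⟨h3, h4⟩ := hpos (F + W) fun z => by
    have := neg_le_of_abs_le (hC z)
    simp only [Submodule.coe_add, Pi.add_apply, hW]
    linarith
  have hF : (F : Z → ℝ) = fun z => ((F + W : quadGrowth Z) : Z → ℝ) z - (W : Z → ℝ) z := by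
    ext z; simp
  constructor
  · rw [hF]; exact h3.sub h1
  · rw [hF, integral_sub h3 h1, h4, h2, map_add]; ring

end Representation

section HahnBanach

/-- A positive linear relation on an ordered vector space that is majorising extends to a positive
linear functional, which may be chosen maximal at a given vector. -/
theorem exists_positive_functional {E : Type*} [AddCommGroup E] [PartialOrder E]
    [IsOrderedAddMonoid E] [Module ℝ E] [PosSMulMono ℝ E] (V : Submodule ℝ (E × ℝ))
    (hpos : ∀ F r, (F, r) ∈ V → 0 ≤ F → 0 ≤ r)
    (hdom : ∀ F, ∃ G r, (G, r) ∈ V ∧ F ≤ G) (F₀ : E) :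
    ∃ L : E →ₗ[ℝ] ℝ, (∀ F, 0 ≤ F → 0 ≤ L F) ∧ (∀ F r, (F, r) ∈ V → L F = r) ∧
      ∀ s, (∀ G r, (G, r) ∈ V → F₀ ≤ G → s ≤ r) → s ≤ L F₀ := by
  let S (F : E) : Set ℝ := {r | ∃ G, (G, r) ∈ V ∧ F ≤ G}
  let N (F : E) : ℝ := sInf (S F)
  have hne (F) : (S F).Nonempty := by
    obtain ⟨G, r, h, hF⟩ := hdom F
    exact ⟨r, G, h, hF⟩
  have hbdd (F) : BddBelow (S F) := by
    obtain ⟨G, r, h, hF⟩ := hdom (-F)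
    refine ⟨-r, ?_⟩
    rintro s ⟨H, hH, hFH⟩
    have := hpos _ _ (V.add_mem hH h) (by
      change 0 ≤ H + G
      calc 0 = F + -F := by simp
        _ ≤ H + G := add_le_add hFH hF)
    linarith
  have hNle {F r} (h : r ∈ S F) : N F ≤ r := csInf_le (hbdd F) h
  have hSsmul {c : ℝ} (hc : 0 ≤ c) {F r} (h : r ∈ S F) : c * r ∈ S (c • F) := by
    obtain ⟨G, hG, hF⟩ := h
    exact ⟨c • G, V.smul_mem c hG, smul_le_smul_of_nonneg_left hF hc⟩
  have hNsmul_le {c : ℝ} (hc : 0 < c) (F) : N (c • F) ≤ c * N F := by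
    rw [← div_le_iff₀' hc]
    refine le_csInf (hne F) fun r hr => ?_
    rw [div_le_iff₀' hc]
    exact hNle (hSsmul hc.le hr)
  have hNsmul (c : ℝ) (hc : 0 < c) (F) : N (c • F) = c * N F := by
    refine le_antisymm (hNsmul_le hc F) ?_
    have := hNsmul_le (inv_pos.2 hc) (c • F)
    rw [inv_smul_smul₀ hc.ne'] at this
    rwa [← div_eq_inv_mul, le_div_iff₀' hc] at this
  have hNadd (F G) : N (F + G) ≤ N F + N G := by
    refine le_of_forall_pos_le_add fun ε hε => ?_
    obtain ⟨r, ⟨F', hF', hF⟩, hr⟩ := exists_lt_of_csInf_lt (hne F)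
      (lt_add_of_pos_right (N F) (half_pos hε))
    obtain ⟨s, ⟨G', hG', hG⟩, hs⟩ := exists_lt_of_csInf_lt (hne G)
      (lt_add_of_pos_right (N G) (half_pos hε))
    have := hNle (F := F + G) ⟨F' + G', V.add_mem hF' hG', add_le_add hF hG⟩
    linarith
  have hN0 : N 0 = 0 := by
    refine le_antisymm (hNle ⟨0, V.zero_mem, le_rfl⟩) (le_csInf (hne 0) ?_)
    rintro r ⟨G, hG, h⟩
    exact hpos _ _ hG h
  have hsingle (c : ℝ) : c * N F₀ ≤ N (c • F₀) := by
    rcases lt_trichotomy c 0 with hc | rfl | hc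
    · have h1 := hNadd (c • F₀) (-c • F₀)
      rw [← add_smul, add_neg_cancel, zero_smul, hN0, hNsmul (-c) (by linarith)] at h1
      linarith
    · simp [hN0]
    · exact (hNsmul c hc F₀).ge
  let f : E →ₗ.[ℝ] ℝ := LinearPMap.mkSpanSingleton' (σ := RingHom.id ℝ) F₀ (N F₀) fun c hc => by
    have h1 := hsingle c
    have h2 := hsingle (-c)
    rw [neg_smul] at h2
    rw [hc] at h1 h2
    rw [neg_zero] at h2
    rw [hN0] at h1 h2
    simp only [RingHom.id_apply, smul_eq_mul]
    linarith
  obtain ⟨L, hLf, hLN⟩ := exists_extension_of_le_sublinear f N hNsmul hNadd (by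
    rintro ⟨x, hx⟩
    obtain ⟨c, rfl⟩ := Submodule.mem_span_singleton.1 hx
    have := LinearPMap.mkSpanSingleton'_apply (σ := RingHom.id ℝ) F₀ (N F₀) _ c hx
    simp only [f]
    rw [this]
    exact hsingle c)
  have hle : ∀ F r, (F, r) ∈ V → L F ≤ r := fun F r h => (hLN F).trans (hNle ⟨F, h, le_rfl⟩)
  refine ⟨L, fun F hF => ?_, fun F r h => le_antisymm (hle F r h) ?_, fun s hs => ?_⟩
  · have := (hLN (-F)).trans (hNle ⟨0, V.zero_mem, neg_nonpos.2 hF⟩)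
    rw [map_neg] at this
    linarith
  · have := hle _ _ (V.neg_mem h)
    rw [map_neg] at this
    linarith
  · have h1 : L F₀ = N F₀ := by
      have hmem : F₀ ∈ f.domain := Submodule.mem_span_singleton_self F₀
      rw [hLf ⟨F₀, hmem⟩]
      exact LinearPMap.mkSpanSingleton'_apply_self (σ := RingHom.id ℝ) F₀ (N F₀) _ hmem
    rw [h1]
    refine le_csInf (hne F₀) ?_
    rintro r ⟨G, hG, hF⟩
    exact hs G r hG hF

end HahnBanach

section Couplings

variable {X Y : Type*} [NormedAddCommGroup X] [NormedAddCommGroup Y]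

/-- The function `(x, y) ↦ g x + h y`. -/
def tensorSum (g : quadGrowth X) (h : quadGrowth Y) : quadGrowth (X × Y) :=
  ⟨fun p => (g : X → ℝ) p.1 + (h : Y → ℝ) p.2,
    (quadGrowth (X × Y)).add_mem (quadGrowth_comp_fst g.2) (quadGrowth_comp_snd h.2)⟩

@[simp] lemma tensorSum_apply (g : quadGrowth X) (h : quadGrowth Y) (p : X × Y) :
    (tensorSum g h : X × Y → ℝ) p = (g : X → ℝ) p.1 + (h : Y → ℝ) p.2 := rfl

lemma exists_tensorSum_ge (F : quadGrowth (X × Y)) :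
    ∃ (g : quadGrowth X) (h : quadGrowth Y), F ≤ tensorSum g h := by
  obtain ⟨hFc, C, hC⟩ := F.2
  have hC0 : 0 ≤ C := by simpa using (abs_nonneg _).trans (hC 0)
  refine ⟨C • ⟨_, one_add_norm_sq_mem_quadGrowth X⟩, C • ⟨_, one_add_norm_sq_mem_quadGrowth Y⟩,
    fun p => ((le_abs_self _).trans (hC p)).trans ?_⟩
  change C * (1 + ‖p‖ ^ 2) ≤ C * (1 + ‖p.1‖ ^ 2) + C * (1 + ‖p.2‖ ^ 2)
  rw [← mul_add]
  refine mul_le_mul_of_nonneg_left ?_ hC0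
  rcases max_choice ‖p.1‖ ‖p.2‖ with h | h <;> rw [← Prod.norm_def] at h <;> rw [h] <;>
    nlinarith [sq_nonneg ‖p.1‖, sq_nonneg ‖p.2‖]

lemma boundedContinuous_mem_quadGrowth (f : BoundedContinuousFunction X ℝ) :
    (f : X → ℝ) ∈ quadGrowth X :=
  ⟨f.continuous, ‖f‖, fun x => (f.norm_coe_le_norm x).trans
    (le_mul_of_one_le_right (norm_nonneg f) (by nlinarith [sq_nonneg ‖x‖]))⟩

variable [ProperSpace X] [ProperSpace Y] [MeasurableSpace X] [BorelSpace X]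
  [MeasurableSpace Y] [BorelSpace Y]

/-- A positive linear relation between functions of quadratic growth and reals that contains the
sums `g ⊕ h` with their integrals is represented by a coupling, which may be chosen so as to
maximise the integral of a given function. -/
theorem exists_coupling_of_positive {μ : Measure X} {ν : Measure Y} [IsProbabilityMeasure μ]
    [IsProbabilityMeasure ν] (hμ : Integrable (fun x => ‖x‖ ^ 2) μ)
    (hν : Integrable (fun y => ‖y‖ ^ 2) ν) (V : Submodule ℝ (quadGrowth (X × Y) × ℝ))
    (hpos : ∀ F r, (F, r) ∈ V → 0 ≤ F → 0 ≤ r)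
    (hsum : ∀ g h, (tensorSum g h,
      ∫ x, (g : X → ℝ) x ∂μ + ∫ y, (h : Y → ℝ) y ∂ν) ∈ V) (F₀ : quadGrowth (X × Y)) :
    ∃ π : Measure (X × Y), π.map Prod.fst = μ ∧ π.map Prod.snd = ν ∧
      (∀ F r, (F, r) ∈ V → ∫ p, (F : X × Y → ℝ) p ∂π = r) ∧
      ∀ s, (∀ G r, (G, r) ∈ V → F₀ ≤ G → s ≤ r) → s ≤ ∫ p, (F₀ : X × Y → ℝ) p ∂π := by
  have : PosSMulMono ℝ (quadGrowth (X × Y)) :=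
    ⟨fun c hc F G h p => mul_le_mul_of_nonneg_left (h p) hc⟩
  obtain ⟨L, hL, hLV, hL₀⟩ := exists_positive_functional V hpos (fun F => by
    obtain ⟨g, h, hF⟩ := exists_tensorSum_ge F
    exact ⟨_, _, hsum g h, hF⟩) F₀
  have hLsum (g : quadGrowth X) (h : quadGrowth Y) := hLV _ _ (hsum g h)
  have htail : Tendsto (fun n => L (quadTail (X × Y) n)) atTop (𝓝 0) := by
    have h1 := (tendsto_integral_quadTail hμ).add (tendsto_integral_quadTail hν)
    rw [add_zero] at h1
    refine tendsto_of_tendsto_of_tendsto_of_le_of_le tendsto_const_nhds h1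
      (fun n => hL _ fun p => quadTail_nonneg n p) fun n => ?_
    have := hL (tensorSum (quadTail X n) (quadTail Y n) - quadTail (X × Y) n)
      fun p => sub_nonneg.2 (quadTail_prod_le n p)
    rw [map_sub, hLsum] at this
    dsimp only
    linarith
  obtain ⟨π, hπ⟩ := exists_measure_of_positive L (fun F hF => hL F hF) htail
  have : IsFiniteMeasure π := by
    have h1 := (hπ (tensorSum ⟨_, one_add_norm_sq_mem_quadGrowth X⟩
      ⟨_, one_add_norm_sq_mem_quadGrowth Y⟩)).1
    have h2 : Integrable (fun _ : X × Y => (1 : ℝ)) π := by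
      refine h1.mono' aestronglyMeasurable_const (ae_of_all _ fun p => ?_)
      simp only [tensorSum_apply, norm_one]
      nlinarith [sq_nonneg ‖p.1‖, sq_nonneg ‖p.2‖]
    exact (integrable_const_iff_isFiniteMeasure one_ne_zero).1 h2
  refine ⟨π, ?_, ?_, fun F r h => (hπ F).2.trans (hLV F r h), fun s hs => ?_⟩
  · refine ext_of_forall_integral_eq_of_IsFiniteMeasure fun f => ?_
    rw [integral_map measurable_fst.aemeasurable f.continuous.measurable.aestronglyMeasurable]
    have h1 := (hπ (tensorSum ⟨f, boundedContinuous_mem_quadGrowth f⟩ 0)).2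
    rw [hLsum] at h1
    simpa using h1
  · refine ext_of_forall_integral_eq_of_IsFiniteMeasure fun f => ?_
    rw [integral_map measurable_snd.aemeasurable f.continuous.measurable.aestronglyMeasurable]
    have h1 := (hπ (tensorSum 0 ⟨f, boundedContinuous_mem_quadGrowth f⟩)).2
    rw [hLsum] at h1
    simpa using h1
  · rw [(hπ F₀).2]
    exact hL₀ s hs

end Couplings

section ConvexOrder

variable {d : ℕ} {μ ν η : Measure (Rd d)} {φ : Rd d → ℝ}

lemma mem_P2_iff :
    μ ∈ P2 d ↔ IsProbabilityMeasure μ ∧ Integrable (fun x => ‖x‖ ^ 2) μ := by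
  refine and_congr_right fun _ => ?_
  have h : (fun x : Rd d => ‖‖x‖ ^ 2‖ₑ) = fun x => ‖x‖ₑ ^ 2 := by ext x; simp
  rw [Integrable, HasFiniteIntegral, h]
  exact ⟨fun h => ⟨by fun_prop, h⟩, fun h => h.2⟩

lemma ConvexOn.continuous_Rd (hφ : ConvexOn ℝ Set.univ φ) : Continuous φ :=
  hφ.locallyLipschitz.continuous

lemma ConvexOn.exists_neg_le (hφ : ConvexOn ℝ Set.univ φ) :
    ∃ C, ∀ x, -(C * (1 + ‖x‖)) ≤ φ x := by
  obtain ⟨l, c, h, -⟩ := exists_affine_le_of_lt (𝕜 := ℝ) (φ := φ) (x := 0) (a := φ 0 - 1)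
    (Set.mem_univ _) (by linarith) isClosed_univ
    (hφ.continuous_Rd.lowerSemicontinuous.lowerSemicontinuousOn _) hφ
  refine ⟨max ‖l‖ |c|, fun x => ?_⟩
  have h1 : l x + c ≤ φ x := h ⟨x, Set.mem_univ x⟩
  have h2 := neg_le_of_abs_le (l.le_opNorm x)
  have h3 := neg_abs_le c
  have h4 := mul_le_mul_of_nonneg_right (le_max_left ‖l‖ |c|) (norm_nonneg x)
  have h5 := le_max_right ‖l‖ |c|
  linarith

lemma integrable_norm_of_mem_P2 (hμ : μ ∈ P2 d) : Integrable (fun x => ‖x‖) μ := by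
  obtain ⟨_, h⟩ := mem_P2_iff.1 hμ
  refine ((integrable_const 1).add h).mono' (by fun_prop) (ae_of_all _ fun x => ?_)
  simp only [norm_norm, Pi.add_apply]
  nlinarith [sq_nonneg (‖x‖ - 1), sq_nonneg ‖x‖]

lemma lintegral_ofReal_neg_ne_top (hμ : μ ∈ P2 d) (hφ : ConvexOn ℝ Set.univ φ) :
    ∫⁻ x, ENNReal.ofReal (-φ x) ∂μ ≠ ∞ := by
  obtain ⟨C, hC⟩ := hφ.exists_neg_le
  have := hμ.1
  have h : Integrable (fun x => C * (1 + ‖x‖)) μ :=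
    ((integrable_const 1).add (integrable_norm_of_mem_P2 hμ)).const_mul C
  refine ((lintegral_mono fun x => ?_).trans_lt h.lintegral_lt_top).ne
  exact ENNReal.ofReal_le_ofReal (by linarith [hC x])

lemma extIntegral_of_integrable (h : Integrable φ μ) :
    extIntegral φ μ = ((∫ x, φ x ∂μ : ℝ) : EReal) := by
  rw [integral_eq_lintegral_pos_part_sub_lintegral_neg_part h, EReal.coe_sub,
    EReal.coe_ennreal_toReal h.lintegral_lt_top.ne,
    EReal.coe_ennreal_toReal (by simpa using h.neg.lintegral_lt_top.ne)]
  rfl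

lemma extIntegral_eq_top_of_not_integrable (hμ : μ ∈ P2 d) (hφ : ConvexOn ℝ Set.univ φ)
    (h : ¬ Integrable φ μ) : extIntegral φ μ = ⊤ := by
  have hneg := lintegral_ofReal_neg_ne_top hμ hφ
  have hpos : ∫⁻ x, ENNReal.ofReal (φ x) ∂μ = ∞ := by
    by_contra hpos
    refine h ⟨hφ.continuous_Rd.measurable.aestronglyMeasurable, ?_⟩
    have : ∀ x, ‖φ x‖ₑ = ENNReal.ofReal (φ x) + ENNReal.ofReal (-φ x) := fun x => by
      rw [Real.enorm_eq_ofReal_abs]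
      rcases le_total 0 (φ x) with hx | hx
      · rw [abs_of_nonneg hx, ENNReal.ofReal_of_nonpos (neg_nonpos.2 hx), add_zero]
      · rw [abs_of_nonpos hx, ENNReal.ofReal_of_nonpos hx, zero_add]
    rw [HasFiniteIntegral, lintegral_congr this,
      lintegral_add_left hφ.continuous_Rd.measurable.ennreal_ofReal]
    exact ENNReal.add_lt_top.2 ⟨lt_top_iff_ne_top.2 hpos, lt_top_iff_ne_top.2 hneg⟩
  rw [extIntegral, hpos, EReal.coe_ennreal_top, EReal.top_sub]
  simpa using hneg

lemma convexOrder_iff (hη : η ∈ P2 d) (hν : ν ∈ P2 d) :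
    ConvexOrder η ν ↔ ∀ φ : Rd d → ℝ, ConvexOn ℝ Set.univ φ → Integrable φ ν →
      Integrable φ η ∧ ∫ x, φ x ∂η ≤ ∫ x, φ x ∂ν := by
  constructor
  · intro h φ hφ hφν
    have h1 := h φ hφ (Or.inr (lintegral_ofReal_neg_ne_top hη hφ))
      (Or.inr (lintegral_ofReal_neg_ne_top hν hφ))
    rw [extIntegral_of_integrable hφν] at h1
    have h2 : Integrable φ η := by
      by_contra h2
      rw [extIntegral_eq_top_of_not_integrable hη hφ h2] at h1
      exact absurd (top_le_iff.1 h1) (EReal.coe_ne_top _)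
    rw [extIntegral_of_integrable h2] at h1
    exact ⟨h2, EReal.coe_le_coe_iff.1 h1⟩
  · intro h φ hφ _ _
    by_cases hφν : Integrable φ ν
    · obtain ⟨h1, h2⟩ := h φ hφ hφν
      rw [extIntegral_of_integrable h1, extIntegral_of_integrable hφν]
      exact EReal.coe_le_coe_iff.2 h2
    · rw [extIntegral_eq_top_of_not_integrable hν hφ hφν]
      exact le_top

lemma ConvexOrder.mem_P2 [IsProbabilityMeasure η] (h : ConvexOrder η ν) (hν : ν ∈ P2 d) :
    η ∈ P2 d := by
  refine ⟨inferInstance, ?_⟩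
  have hφ : ConvexOn ℝ Set.univ fun x : Rd d => ‖x‖ ^ 2 :=
    convexOn_univ_norm.pow (fun _ _ => norm_nonneg _) 2
  have h0 : ∀ x : Rd d, ENNReal.ofReal (-‖x‖ ^ 2) = 0 := fun x =>
    ENNReal.ofReal_of_nonpos (neg_nonpos.2 (by positivity))
  have h1 := h _ hφ (Or.inr (by simp [h0])) (Or.inr (by simp [h0]))
  have h2 : ∀ x : Rd d, ENNReal.ofReal (‖x‖ ^ 2) = ‖x‖ₑ ^ 2 := fun x => by
    rw [ENNReal.ofReal_pow (norm_nonneg x), ofReal_norm]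
  simp only [extIntegral, h0, h2, lintegral_zero, EReal.coe_ennreal_zero, sub_zero,
    EReal.coe_ennreal_le_coe_ennreal_iff] at h1
  exact h1.trans_lt hν.2

end ConvexOrder

section Barycenter

variable {d : ℕ} {μ ν : Measure (Rd d)} {k : Kernel (Rd d) (Rd d)}

lemma stronglyMeasurable_barycenterMap [IsMarkovKernel k] : StronglyMeasurable (barycenterMap k) :=
  stronglyMeasurable_id.integral_kernel

/-- Jensen's inequality for the barycentre map of a kernel. -/
lemma integral_comp_barycenterMap_le [IsProbabilityMeasure μ] [IsMarkovKernel k]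
    (hk : (μ ⊗ₘ k).map Prod.snd = ν) (hν : ν ∈ P2 d) {φ : Rd d → ℝ}
    (hφ : ConvexOn ℝ Set.univ φ) (hφν : Integrable φ ν) :
    Integrable (fun x => φ (barycenterMap k x)) μ ∧
      ∫ x, φ (barycenterMap k x) ∂μ ≤ ∫ y, φ y ∂ν := by
  have hcomp {f : Rd d → ℝ} (hf : Integrable f ν) :
      Integrable (fun p : Rd d × Rd d => f p.2) (μ ⊗ₘ k) := by
    rw [← hk] at hf
    exact hf.comp_measurable measurable_snd
  have hint {f : Rd d → ℝ} (hf : Integrable f ν) : ∫ x, ∫ y, f y ∂k x ∂μ = ∫ y, f y ∂ν := by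
    rw [← Measure.integral_compProd (hcomp hf), ← hk,
      integral_map measurable_snd.aemeasurable (by rw [hk]; exact hf.1)]
  have hnorm := integrable_norm_of_mem_P2 hν
  have hφc := hφ.continuous_Rd
  have h1 : ∀ᵐ x ∂μ, φ (barycenterMap k x) ≤ ∫ y, φ y ∂k x := by
    filter_upwards [(hcomp hφν).ae_of_compProd, (hcomp hnorm).ae_of_compProd] with x hx hx'
    exact hφ.map_integral_le hφc.continuousOn isClosed_univ (by simp)
      ((integrable_norm_iff (by fun_prop)).1 hx') hx
  have h2 : Integrable (fun x => ∫ y, φ y ∂k x) μ := (hcomp hφν).integral_compProd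
  have h3 : Integrable (fun x => ∫ y, ‖y‖ ∂k x) μ := (hcomp hnorm).integral_compProd
  obtain ⟨C, hC⟩ := hφ.exists_neg_le
  have h4 : Integrable (fun x => φ (barycenterMap k x)) μ := by
    refine ((h2.abs).add (((integrable_const 1).add h3).const_mul |C|)).mono'
      (hφc.comp_stronglyMeasurable stronglyMeasurable_barycenterMap).aestronglyMeasurable ?_
    filter_upwards [h1] with x hx
    have hT : ‖barycenterMap k x‖ ≤ ∫ y, ‖y‖ ∂k x := norm_integral_le_integral_norm _
    have h5 := hC (barycenterMap k x)
    have h6 : C * (1 + ‖barycenterMap k x‖) ≤ |C| * (1 + ∫ y, ‖y‖ ∂k x) :=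
      mul_le_mul (le_abs_self C) (by linarith) (by positivity) (abs_nonneg C)
    have h7 : 0 ≤ |C| * (1 + ∫ y, ‖y‖ ∂k x) := by positivity
    have h8 := le_abs_self (∫ y, φ y ∂k x)
    have h9 := abs_nonneg (∫ y, φ y ∂k x)
    simp only [Pi.add_apply, Real.norm_eq_abs]
    rw [abs_le]
    constructor <;> linarith
  refine ⟨h4, ?_⟩
  rw [← hint hφν]
  exact integral_mono_ae h4 h2 h1

lemma map_barycenterMap_mem_P2 [IsProbabilityMeasure μ] [IsMarkovKernel k]
    (hk : (μ ⊗ₘ k).map Prod.snd = ν) (hν : ν ∈ P2 d) : μ.map (barycenterMap k) ∈ P2 d := by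
  have hm := (stronglyMeasurable_barycenterMap (k := k)).measurable
  refine mem_P2_iff.2 ⟨Measure.isProbabilityMeasure_map hm.aemeasurable, ?_⟩
  rw [integrable_map_measure (by fun_prop) hm.aemeasurable]
  exact (integral_comp_barycenterMap_le hk hν
    (convexOn_univ_norm.pow (fun _ _ => norm_nonneg _) 2) (mem_P2_iff.1 hν).2).1

lemma convexOrder_map_barycenterMap [IsProbabilityMeasure μ] [IsMarkovKernel k]
    (hk : (μ ⊗ₘ k).map Prod.snd = ν) (hν : ν ∈ P2 d) :
    ConvexOrder (μ.map (barycenterMap k)) ν := by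
  have hm := (stronglyMeasurable_barycenterMap (k := k)).measurable
  rw [convexOrder_iff (map_barycenterMap_mem_P2 hk hν) hν]
  intro φ hφ hφν
  have hφm := hφ.continuous_Rd.measurable.aestronglyMeasurable (μ := μ.map (barycenterMap k))
  rw [integrable_map_measure hφm hm.aemeasurable, integral_map hm.aemeasurable hφm]
  exact integral_comp_barycenterMap_le hk hν hφ hφν

end Barycenter

section SecondMoment

variable {X Y : Type*} [NormedAddCommGroup X] [NormedAddCommGroup Y]
  [MeasurableSpace X] [OpensMeasurableSpace X] [MeasurableSpace Y] [OpensMeasurableSpace Y]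
  [SecondCountableTopology X]

lemma integrable_norm_sq_of_marginals {π : Measure (X × Y)}
    (h₁ : Integrable (fun x => ‖x‖ ^ 2) (π.map Prod.fst))
    (h₂ : Integrable (fun y => ‖y‖ ^ 2) (π.map Prod.snd)) :
    Integrable (fun p => ‖p‖ ^ 2) π := by
  refine ((h₁.comp_measurable measurable_fst).add (h₂.comp_measurable measurable_snd)).mono'
    (by fun_prop) (ae_of_all _ fun p => ?_)
  simp only [Function.comp_apply, Pi.add_apply, norm_pow, norm_norm]
  rcases max_choice ‖p.1‖ ‖p.2‖ with h | h <;> rw [← Prod.norm_def] at h <;> rw [h] <;>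
    nlinarith [sq_nonneg ‖p.1‖, sq_nonneg ‖p.2‖]

end SecondMoment

section Correlation

variable {d : ℕ} {μ ν η : Measure (Rd d)} {π : Measure (Rd d × Rd d)}

/-- The integral of the inner product of the two coordinates. -/
noncomputable def innerIntegral (π : Measure (Rd d × Rd d)) : ℝ := ∫ p, inner ℝ p.1 p.2 ∂π

lemma isProbabilityMeasure_of_mem_couplings (hμ : μ ∈ P2 d) (hπ : π ∈ couplings μ ν) :
    IsProbabilityMeasure π := by
  have := hμ.1
  rw [← hπ.1] at this
  exact Measure.isProbabilityMeasure_of_map Prod.fst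

lemma integrable_norm_sq_of_mem_couplings (hμ : μ ∈ P2 d) (hν : ν ∈ P2 d)
    (hπ : π ∈ couplings μ ν) : Integrable (fun p => ‖p‖ ^ 2) π := by
  refine integrable_norm_sq_of_marginals ?_ ?_
  · rw [hπ.1]; exact (mem_P2_iff.1 hμ).2
  · rw [hπ.2]; exact (mem_P2_iff.1 hν).2

lemma integrable_of_mem_couplings (hμ : μ ∈ P2 d) (hν : ν ∈ P2 d)
    (hπ : π ∈ couplings μ ν) {F : Rd d × Rd d → ℝ} (hF : F ∈ quadGrowth (Rd d × Rd d)) :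
    Integrable F π :=
  have := isProbabilityMeasure_of_mem_couplings hμ hπ
  integrable_of_mem_quadGrowth (integrable_norm_sq_of_mem_couplings hμ hν hπ) hF

lemma inner_mem_quadGrowth :
    (fun p : Rd d × Rd d => inner ℝ p.1 p.2) ∈ quadGrowth (Rd d × Rd d) := by
  refine mem_quadGrowth_of_abs_le (by fun_prop) (one_add_norm_sq_mem_quadGrowth _) fun p => ?_
  have h1 := abs_real_inner_le_norm p.1 p.2
  have h2 := mul_le_mul (norm_fst_le p) (norm_snd_le p) (norm_nonneg _) (norm_nonneg _)
  nlinarith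

lemma norm_sq_mem_quadGrowth : (fun x : Rd d => ‖x‖ ^ 2) ∈ quadGrowth (Rd d) :=
  mem_quadGrowth_of_abs_le (by fun_prop) (one_add_norm_sq_mem_quadGrowth _) fun x => by
    rw [abs_of_nonneg (by positivity)]; linarith

lemma integral_comp_fst_of_mem_couplings (hπ : π ∈ couplings μ ν) {f : Rd d → ℝ}
    (hf : Continuous f) : ∫ p, f p.1 ∂π = ∫ x, f x ∂μ := by
  rw [← hπ.1, integral_map measurable_fst.aemeasurable hf.measurable.aestronglyMeasurable]

lemma integral_comp_snd_of_mem_couplings (hπ : π ∈ couplings μ ν) {f : Rd d → ℝ}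
    (hf : Continuous f) : ∫ p, f p.2 ∂π = ∫ x, f x ∂ν := by
  rw [← hπ.2, integral_map measurable_snd.aemeasurable hf.measurable.aestronglyMeasurable]

lemma integral_norm_sub_sq (hμ : μ ∈ P2 d) (hν : ν ∈ P2 d) (hπ : π ∈ couplings μ ν) :
    Integrable (fun p : Rd d × Rd d => ‖p.2 - p.1‖ ^ 2) π ∧ ∫ p, ‖p.2 - p.1‖ ^ 2 ∂π
      = ∫ x, ‖x‖ ^ 2 ∂μ + ∫ y, ‖y‖ ^ 2 ∂ν - 2 * innerIntegral π := by
  have h1 := integrable_of_mem_couplings hμ hν hπ (quadGrowth_comp_fst norm_sq_mem_quadGrowth)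
  have h2 := integrable_of_mem_couplings hμ hν hπ (quadGrowth_comp_snd norm_sq_mem_quadGrowth)
  have h3 := integrable_of_mem_couplings hμ hν hπ inner_mem_quadGrowth
  have h12 : Integrable (fun p : Rd d × Rd d => ‖p.1‖ ^ 2 + ‖p.2‖ ^ 2) π := h1.add h2
  have h4 : (fun p : Rd d × Rd d => ‖p.2 - p.1‖ ^ 2)
      = fun p => (‖p.1‖ ^ 2 + ‖p.2‖ ^ 2) - 2 * inner ℝ p.1 p.2 := by
    ext p
    rw [norm_sub_sq_real, real_inner_comm]
    ring
  rw [h4]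
  refine ⟨h12.sub (h3.const_mul 2), ?_⟩
  rw [integral_sub h12 (h3.const_mul 2), integral_add h1 h2, integral_const_mul,
    integral_comp_fst_of_mem_couplings hπ (f := fun x => ‖x‖ ^ 2) (by fun_prop),
    integral_comp_snd_of_mem_couplings hπ (f := fun x => ‖x‖ ^ 2) (by fun_prop), innerIntegral]

lemma quadCost_eq (hμ : μ ∈ P2 d) (hν : ν ∈ P2 d) (hπ : π ∈ couplings μ ν) :
    quadCost π = ENNReal.ofReal
      (∫ x, ‖x‖ ^ 2 ∂μ + ∫ y, ‖y‖ ^ 2 ∂ν - 2 * innerIntegral π) := by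
  obtain ⟨h1, h2⟩ := integral_norm_sub_sq hμ hν hπ
  rw [← h2, ofReal_integral_eq_lintegral_ofReal h1 (ae_of_all _ fun p => by positivity), quadCost]
  refine lintegral_congr fun p => ?_
  rw [ENNReal.ofReal_pow (norm_nonneg _), ofReal_norm]

lemma sub_innerIntegral_nonneg (hμ : μ ∈ P2 d) (hν : ν ∈ P2 d) (hπ : π ∈ couplings μ ν) :
    0 ≤ ∫ x, ‖x‖ ^ 2 ∂μ + ∫ y, ‖y‖ ^ 2 ∂ν - 2 * innerIntegral π := by
  rw [← (integral_norm_sub_sq hμ hν hπ).2]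
  exact integral_nonneg fun p => by positivity

lemma integral_tensorSum (hμ : μ ∈ P2 d) (hν : ν ∈ P2 d) (hπ : π ∈ couplings μ ν)
    (g h : quadGrowth (Rd d)) :
    ∫ p, (tensorSum g h : Rd d × Rd d → ℝ) p ∂π
      = ∫ x, (g : Rd d → ℝ) x ∂μ + ∫ y, (h : Rd d → ℝ) y ∂ν := by
  simp only [tensorSum_apply]
  rw [integral_add (integrable_of_mem_couplings hμ hν hπ (quadGrowth_comp_fst g.2))
    (integrable_of_mem_couplings hμ hν hπ (quadGrowth_comp_snd h.2)),
    integral_comp_fst_of_mem_couplings hπ g.2.1, integral_comp_snd_of_mem_couplings hπ h.2.1]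

lemma prod_mem_couplings [IsProbabilityMeasure μ] [IsProbabilityMeasure ν] :
    μ.prod ν ∈ couplings μ ν :=
  ⟨by simp [Measure.map_fst_prod], by simp [Measure.map_snd_prod]⟩

/-- Existence of a quadratic-cost optimal coupling, in terms of the inner product. -/
theorem exists_innerIntegral_max (hμ : μ ∈ P2 d) (hν : ν ∈ P2 d) :
    ∃ π ∈ couplings μ ν, ∀ π' ∈ couplings μ ν, innerIntegral π' ≤ innerIntegral π := by
  obtain ⟨_, hμ2⟩ := mem_P2_iff.1 hμ
  obtain ⟨_, hν2⟩ := mem_P2_iff.1 hν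
  have hgμ (g : quadGrowth (Rd d)) := integrable_of_mem_quadGrowth hμ2 g.2
  have hgν (g : quadGrowth (Rd d)) := integrable_of_mem_quadGrowth hν2 g.2
  let V : Submodule ℝ (quadGrowth (Rd d × Rd d) × ℝ) :=
    { carrier := {q | ∃ g h, q = (tensorSum g h,
        ∫ x, (g : Rd d → ℝ) x ∂μ + ∫ y, (h : Rd d → ℝ) y ∂ν)}
      zero_mem' := ⟨0, 0, Prod.ext (by ext; simp) (by simp)⟩
      add_mem' := by
        rintro _ _ ⟨g, h, rfl⟩ ⟨g', h', rfl⟩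
        refine ⟨g + g', h + h', Prod.ext ?_ ?_⟩
        · ext p; simp; ring
        · simp only [Prod.mk_add_mk, Submodule.coe_add, Pi.add_apply]
          rw [integral_add (hgμ g) (hgμ g'), integral_add (hgν h) (hgν h')]
          ring
      smul_mem' := by
        rintro c _ ⟨g, h, rfl⟩
        refine ⟨c • g, c • h, Prod.ext ?_ ?_⟩
        · ext p; simp; ring
        · simp only [Prod.smul_mk, Submodule.coe_smul, Pi.smul_apply, smul_eq_mul]
          rw [integral_const_mul, integral_const_mul]
          ring }
  obtain ⟨π, h1, h2, -, h3⟩ := exists_coupling_of_positive hμ2 hν2 V (by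
    rintro F r ⟨g, h, hq⟩ hF
    obtain ⟨rfl, rfl⟩ := Prod.mk.inj hq
    rw [← integral_tensorSum hμ hν prod_mem_couplings]
    exact integral_nonneg hF) (fun g h => ⟨g, h, rfl⟩) ⟨_, inner_mem_quadGrowth⟩
  refine ⟨π, ⟨h1, h2⟩, fun π' hπ' => h3 _ ?_⟩
  rintro G r ⟨g, h, hq⟩ hG
  obtain ⟨rfl, rfl⟩ := Prod.mk.inj hq
  rw [← integral_tensorSum hμ hν hπ']
  exact integral_mono (integrable_of_mem_couplings hμ hν hπ' inner_mem_quadGrowth)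
    (integrable_of_mem_couplings hμ hν hπ' (tensorSum g h).2) hG

lemma W2sq_eq_quadCost (hμ : μ ∈ P2 d) (hν : ν ∈ P2 d) (hπ : π ∈ couplings μ ν)
    (hmax : ∀ π' ∈ couplings μ ν, innerIntegral π' ≤ innerIntegral π) :
    W2sq μ ν = quadCost π := by
  refine le_antisymm (iInf₂_le π hπ) (le_iInf₂ fun π' hπ' => ?_)
  rw [quadCost_eq hμ hν hπ, quadCost_eq hμ hν hπ']
  exact ENNReal.ofReal_le_ofReal (by linarith [hmax π' hπ'])

/-- The largest integral of the inner product among the couplings of two measures. -/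
noncomputable def maxInner (μ ν : Measure (Rd d)) : ℝ := sSup (innerIntegral '' couplings μ ν)

lemma exists_innerIntegral_eq_maxInner (hμ : μ ∈ P2 d) (hν : ν ∈ P2 d) :
    ∃ π ∈ couplings μ ν, innerIntegral π = maxInner μ ν := by
  obtain ⟨π, hπ, h⟩ := exists_innerIntegral_max hμ hν
  exact ⟨π, hπ, (IsGreatest.csSup_eq (s := innerIntegral '' couplings μ ν)
    ⟨⟨π, hπ, rfl⟩, by rintro _ ⟨π', hπ', rfl⟩; exact h π' hπ'⟩).symm⟩

lemma innerIntegral_le_maxInner (hμ : μ ∈ P2 d) (hν : ν ∈ P2 d) (hπ : π ∈ couplings μ ν) :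
    innerIntegral π ≤ maxInner μ ν := by
  obtain ⟨π', hπ', h⟩ := exists_innerIntegral_max hμ hν
  exact le_csSup ⟨innerIntegral π', by rintro _ ⟨p, hp, rfl⟩; exact h p hp⟩ ⟨π, hπ, rfl⟩

lemma W2sq_toReal (hμ : μ ∈ P2 d) (hν : ν ∈ P2 d) : (W2sq μ ν).toReal
    = ∫ x, ‖x‖ ^ 2 ∂μ + ∫ y, ‖y‖ ^ 2 ∂ν - 2 * maxInner μ ν := by
  obtain ⟨π, hπ, h⟩ := exists_innerIntegral_eq_maxInner hμ hν
  rw [W2sq_eq_quadCost hμ hν hπ fun π' hπ' => h ▸ innerIntegral_le_maxInner hμ hν hπ',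
    quadCost_eq hμ hν hπ, ENNReal.toReal_ofReal (sub_innerIntegral_nonneg hμ hν hπ), h]

lemma mem_optCouplings_iff (hμ : μ ∈ P2 d) (hν : ν ∈ P2 d) :
    π ∈ optCouplings μ ν ↔ π ∈ couplings μ ν ∧ innerIntegral π = maxInner μ ν := by
  refine and_congr_right fun hπ => ?_
  constructor
  · intro h
    have h1 := congrArg ENNReal.toReal h
    rw [W2sq_toReal hμ hν, quadCost_eq hμ hν hπ,
      ENNReal.toReal_ofReal (sub_innerIntegral_nonneg hμ hν hπ)] at h1
    linarith
  · intro h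
    exact (W2sq_eq_quadCost hμ hν hπ fun π' hπ' => h ▸ innerIntegral_le_maxInner hμ hν hπ').symm

lemma mem_setI_iff (hμ : μ ∈ P2 d) (hν : ν ∈ P2 d) :
    η ∈ setI μ ν ↔ η ∈ P2 d ∧ ConvexOrder η ν ∧ maxInner μ η = maxInner μ ν := by
  refine and_congr_right fun hη => and_congr_right fun _ => ?_
  rw [W2sq_toReal hμ hν, W2sq_toReal hμ hη]
  constructor <;> intro h <;> linarith

end Correlation

section Strassen

variable {d : ℕ} {μ ν η : Measure (Rd d)} {π : Measure (Rd d × Rd d)}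

lemma convexOn_iSup_of_bddAbove {ι E : Type*} [Nonempty ι] [AddCommGroup E] [Module ℝ E]
    {f : ι → E → ℝ} (hf : ∀ i, ConvexOn ℝ Set.univ (f i))
    (hbdd : ∀ y, BddAbove (Set.range fun i => f i y)) :
    ConvexOn ℝ Set.univ fun y => ⨆ i, f i y := by
  refine ⟨convex_univ, fun x _ y _ a b ha hb hab => ciSup_le fun i => ?_⟩
  refine ((hf i).2 (Set.mem_univ x) (Set.mem_univ y) ha hb hab).trans ?_
  exact add_le_add (mul_le_mul_of_nonneg_left (le_ciSup (hbdd x) i) ha)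
    (mul_le_mul_of_nonneg_left (le_ciSup (hbdd y) i) hb)

/-- The positivity statement dual to the existence of a martingale coupling. -/
lemma integral_add_integral_nonneg_of_convexOrder (hμ : μ ∈ P2 d) (hη : η ∈ P2 d) (hν : ν ∈ P2 d)
    (hπ : π ∈ couplings μ η) (h : ConvexOrder η ν) (g : quadGrowth (Rd d × Rd d))
    (f : quadGrowth (Rd d)) (b : Rd d × Rd d → Rd d)
    (hpos : ∀ ω y, 0 ≤ (g : Rd d × Rd d → ℝ) ω + (f : Rd d → ℝ) y + inner ℝ (b ω) (y - ω.2)) :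
    0 ≤ ∫ ω, (g : Rd d × Rd d → ℝ) ω ∂π + ∫ y, (f : Rd d → ℝ) y ∂ν := by
  obtain ⟨_, hη2⟩ := mem_P2_iff.1 hη
  obtain ⟨_, hν2⟩ := mem_P2_iff.1 hν
  let ψ₀ (ω : Rd d × Rd d) (y : Rd d) : ℝ := -(g : Rd d × Rd d → ℝ) ω - inner ℝ (b ω) (y - ω.2)
  let ψ (y : Rd d) : ℝ := ⨆ ω, ψ₀ ω y
  have hψ₀ (ω y) : ψ₀ ω y ≤ (f : Rd d → ℝ) y := by linarith [hpos ω y]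
  have hbdd (y) : BddAbove (Set.range fun ω => ψ₀ ω y) :=
    ⟨(f : Rd d → ℝ) y, by rintro _ ⟨ω, rfl⟩; exact hψ₀ ω y⟩
  have hψf (y) : ψ y ≤ (f : Rd d → ℝ) y := ciSup_le fun ω => hψ₀ ω y
  have hψge (ω y) : ψ₀ ω y ≤ ψ y := le_ciSup (hbdd y) ω
  have hconv : ConvexOn ℝ Set.univ ψ := by
    refine convexOn_iSup_of_bddAbove (fun ω => ⟨convex_univ, fun x _ y _ s t _ _ hst => ?_⟩) hbdd
    refine le_of_eq ?_
    simp only [ψ₀, inner_sub_right, inner_add_right, inner_smul_right, smul_eq_mul]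
    linear_combination ((g : Rd d × Rd d → ℝ) ω - inner ℝ (b ω) ω.2) * hst
  have hψmem : ψ ∈ quadGrowth (Rd d) := by
    have hlin : (fun y => |ψ₀ 0 y|) ∈ quadGrowth (Rd d) := by
      refine ⟨by fun_prop, |(g : Rd d × Rd d → ℝ) 0| + ‖b 0‖, fun y => ?_⟩
      have h1 := abs_sub (-(g : Rd d × Rd d → ℝ) 0) (inner ℝ (b 0) y)
      have h2 := abs_real_inner_le_norm (b 0) y
      have h3 : ‖y‖ ≤ 1 + ‖y‖ ^ 2 := by nlinarith [sq_nonneg (‖y‖ - 1), sq_nonneg ‖y‖]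
      have h4 := mul_le_mul_of_nonneg_left h3 (norm_nonneg (b 0))
      have h5 := mul_nonneg (abs_nonneg ((g : Rd d × Rd d → ℝ) 0)) (sq_nonneg ‖y‖)
      simp only [ψ₀, Prod.snd_zero, sub_zero, abs_abs]
      rw [abs_neg] at h1
      linarith
    have hf : (fun y => |(f : Rd d → ℝ) y|) ∈ quadGrowth (Rd d) := by
      obtain ⟨hc, C, hC⟩ := f.2
      exact ⟨hc.abs, C, fun y => by rw [abs_abs]; exact hC y⟩
    refine mem_quadGrowth_of_abs_le hconv.continuous_Rd ((quadGrowth (Rd d)).add_mem hlin hf)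
      fun y => ?_
    have h1 := neg_abs_le (ψ₀ 0 y)
    have h2 := le_abs_self ((f : Rd d → ℝ) y)
    have h3 := hψge 0 y
    have h4 := hψf y
    have h5 := abs_nonneg (ψ₀ 0 y)
    have h6 := abs_nonneg ((f : Rd d → ℝ) y)
    simp only [Pi.add_apply]
    rw [abs_le]
    constructor <;> linarith
  have h1 := ((convexOrder_iff hη hν).1 h ψ hconv (integrable_of_mem_quadGrowth hν2 hψmem)).2
  have h2 : ∫ y, ψ y ∂ν ≤ ∫ y, (f : Rd d → ℝ) y ∂ν :=
    integral_mono (integrable_of_mem_quadGrowth hν2 hψmem)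
      (integrable_of_mem_quadGrowth hν2 f.2) hψf
  have h3 : -∫ ω, (g : Rd d × Rd d → ℝ) ω ∂π ≤ ∫ y, ψ y ∂η := by
    rw [← integral_neg, ← integral_comp_snd_of_mem_couplings hπ hconv.continuous_Rd]
    refine integral_mono (integrable_of_mem_couplings hμ hη hπ g.2).neg
      (integrable_of_mem_couplings hμ hη hπ (quadGrowth_comp_snd hψmem)) fun ω => ?_
    simpa [ψ₀] using hψge ω ω.2
  linarith

lemma inner_sub_mem_quadGrowth {b : Rd d × Rd d → Rd d} (hb : Continuous b) {C : ℝ}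
    (hC : ∀ ω, ‖b ω‖ ≤ C * (1 + ‖ω‖)) :
    (fun p : (Rd d × Rd d) × Rd d => (inner ℝ (b p.1) (p.2 - p.1.2) : ℝ))
      ∈ quadGrowth ((Rd d × Rd d) × Rd d) := by
  have hC0 : 0 ≤ C := by simpa using (norm_nonneg _).trans (hC 0)
  refine ⟨by fun_prop, 4 * C, fun p => ?_⟩
  have h1 := norm_fst_le p
  have h2 := norm_snd_le p
  have h3 := (norm_snd_le p.1).trans h1
  have h4 : ‖p.2 - p.1.2‖ ≤ 2 * ‖p‖ := (norm_sub_le _ _).trans (by linarith)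
  have h5 : ‖b p.1‖ ≤ C * (1 + ‖p‖) :=
    (hC p.1).trans (mul_le_mul_of_nonneg_left (by linarith) hC0)
  have h6 := (abs_real_inner_le_norm (b p.1) (p.2 - p.1.2)).trans
    (mul_le_mul h5 h4 (norm_nonneg _) (by positivity))
  have h7 : (1 + ‖p‖) * (2 * ‖p‖) ≤ 4 * (1 + ‖p‖ ^ 2) := by nlinarith [sq_nonneg (‖p‖ - 1)]
  have h8 := mul_le_mul_of_nonneg_left h7 hC0
  linarith

/-- A version of Strassen's theorem: given a coupling of `μ` with `η ≤ ν` in the convex order, a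
third variable with law `ν` can be adjoined so that it is centred at the second one given the
first two. -/
theorem exists_martingale_extension (hμ : μ ∈ P2 d) (hη : η ∈ P2 d) (hν : ν ∈ P2 d)
    (hπ : π ∈ couplings μ η) (h : ConvexOrder η ν) :
    ∃ Q : Measure ((Rd d × Rd d) × Rd d), Q.map Prod.fst = π ∧ Q.map Prod.snd = ν ∧
      ∀ b : Rd d × Rd d → Rd d, Continuous b → (∃ C, ∀ ω, ‖b ω‖ ≤ C * (1 + ‖ω‖)) →
        ∫ p, inner ℝ (b p.1) (p.2 - p.1.2) ∂Q = 0 := by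
  have := isProbabilityMeasure_of_mem_couplings hμ hπ
  obtain ⟨_, hν2⟩ := mem_P2_iff.1 hν
  have hπ2 := integrable_norm_sq_of_mem_couplings hμ hη hπ
  have hgπ (g : quadGrowth (Rd d × Rd d)) := integrable_of_mem_quadGrowth hπ2 g.2
  have hgν (g : quadGrowth (Rd d)) := integrable_of_mem_quadGrowth hν2 g.2
  let V : Submodule ℝ (quadGrowth ((Rd d × Rd d) × Rd d) × ℝ) :=
    { carrier := {q | ∃ (g : quadGrowth (Rd d × Rd d)) (f : quadGrowth (Rd d))
        (b : Rd d × Rd d → Rd d),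
        (∀ p, (q.1 : (Rd d × Rd d) × Rd d → ℝ) p = (g : Rd d × Rd d → ℝ) p.1
          + (f : Rd d → ℝ) p.2 + inner ℝ (b p.1) (p.2 - p.1.2)) ∧
        q.2 = ∫ ω, (g : Rd d × Rd d → ℝ) ω ∂π + ∫ y, (f : Rd d → ℝ) y ∂ν}
      zero_mem' := ⟨0, 0, 0, by simp, by simp⟩
      add_mem' := by
        rintro q q' ⟨g, f, b, h1, h2⟩ ⟨g', f', b', h1', h2'⟩
        refine ⟨g + g', f + f', b + b', fun p => ?_, ?_⟩
        · simp only [Prod.fst_add, Submodule.coe_add, Pi.add_apply, h1, h1', inner_add_left]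
          ring
        · simp only [Prod.snd_add, Submodule.coe_add, Pi.add_apply, h2, h2']
          rw [integral_add (hgπ g) (hgπ g'), integral_add (hgν f) (hgν f')]
          ring
      smul_mem' := by
        rintro c q ⟨g, f, b, h1, h2⟩
        refine ⟨c • g, c • f, c • b, fun p => ?_, ?_⟩
        · simp only [Prod.smul_fst, Submodule.coe_smul, Pi.smul_apply, h1, smul_eq_mul,
            real_inner_smul_left]
          ring
        · simp only [Prod.smul_snd, Submodule.coe_smul, Pi.smul_apply, h2, smul_eq_mul,
            integral_const_mul]
          ring }
  obtain ⟨Q, h1, h2, h3, -⟩ := exists_coupling_of_positive hπ2 hν2 V (by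
    rintro F r ⟨g, f, b, hF, rfl⟩ hF0
    refine integral_add_integral_nonneg_of_convexOrder hμ hη hν hπ h g f b fun ω y => ?_
    rw [← hF (ω, y)]
    exact hF0 (ω, y)) (fun g f => ⟨g, f, 0, by simp, rfl⟩) 0
  refine ⟨Q, h1, h2, fun b hb ⟨C, hC⟩ => ?_⟩
  exact h3 ⟨_, inner_sub_mem_quadGrowth hb hC⟩ 0 ⟨0, 0, b, by simp, by simp⟩

/-- A coupling of `μ` with `η ≤ ν` in the convex order is transformed into a coupling of `μ` and
`ν` with the same conditional barycentres. -/
theorem exists_coupling_of_convexOrder (hμ : μ ∈ P2 d) (hη : η ∈ P2 d) (hν : ν ∈ P2 d)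
    (hπ : π ∈ couplings μ η) (h : ConvexOrder η ν) :
    ∃ π' ∈ couplings μ ν, ∀ b : Rd d → Rd d, Continuous b → (∃ C, ∀ x, ‖b x‖ ≤ C * (1 + ‖x‖)) →
      ∫ p, inner ℝ (b p.1) p.2 ∂π' = ∫ p, inner ℝ (b p.1) p.2 ∂π := by
  obtain ⟨Q, h1, h2, h3⟩ := exists_martingale_extension hμ hη hν hπ h
  have hm : Measurable fun p : (Rd d × Rd d) × Rd d => (p.1.1, p.2) := by fun_prop
  refine ⟨Q.map fun p => (p.1.1, p.2), ⟨?_, ?_⟩, fun b hb ⟨C, hC⟩ => ?_⟩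
  · rw [Measure.map_map measurable_fst hm, ← hπ.1, ← h1,
      Measure.map_map measurable_fst measurable_fst]
    rfl
  · rw [Measure.map_map measurable_snd hm, ← h2]
    rfl
  · have hC0 : 0 ≤ C := by simpa using (norm_nonneg _).trans (hC 0)
    have hC' : ∀ ω : Rd d × Rd d, ‖b ω.1‖ ≤ C * (1 + ‖ω‖) := fun ω =>
      (hC ω.1).trans (mul_le_mul_of_nonneg_left (by linarith [norm_fst_le ω]) hC0)
    have := isProbabilityMeasure_of_mem_couplings hμ hπ
    have : IsProbabilityMeasure Q := by
      rw [← h1] at this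
      exact Measure.isProbabilityMeasure_of_map Prod.fst
    have hQ2 : Integrable (fun p => ‖p‖ ^ 2) Q := by
      refine integrable_norm_sq_of_marginals ?_ ?_
      · rw [h1]; exact integrable_norm_sq_of_mem_couplings hμ hη hπ
      · rw [h2]; exact (mem_P2_iff.1 hν).2
    have hc : Continuous fun p : Rd d × Rd d => (inner ℝ (b p.1) p.2 : ℝ) := by fun_prop
    have h4 : (fun p : Rd d × Rd d => (inner ℝ (b p.1) p.2 : ℝ)) ∈ quadGrowth (Rd d × Rd d) := by
      refine ⟨hc, 2 * C, fun p => ?_⟩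
      have h6 := (abs_real_inner_le_norm (b p.1) p.2).trans
        (mul_le_mul (hC' p) (norm_snd_le p) (norm_nonneg _) (by positivity))
      have h7 : (1 + ‖p‖) * ‖p‖ ≤ 2 * (1 + ‖p‖ ^ 2) := by nlinarith [sq_nonneg (‖p‖ - 1)]
      have h8 := mul_le_mul_of_nonneg_left h7 hC0
      linarith
    have h5 := h3 (fun ω => b ω.1) (by fun_prop) ⟨C, hC'⟩
    have h6 : Integrable (fun p : (Rd d × Rd d) × Rd d => (inner ℝ (b p.1.1) p.1.2 : ℝ)) Q :=
      integrable_of_mem_quadGrowth hQ2 (quadGrowth_comp_fst h4)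
    have h7 : Integrable (fun p : (Rd d × Rd d) × Rd d =>
        (inner ℝ (b p.1.1) (p.2 - p.1.2) : ℝ)) Q :=
      integrable_of_mem_quadGrowth hQ2
        (inner_sub_mem_quadGrowth (b := fun ω => b ω.1) (by fun_prop) hC')
    rw [integral_map hm.aemeasurable hc.measurable.aestronglyMeasurable, ← h1,
      integral_map measurable_fst.aemeasurable hc.measurable.aestronglyMeasurable, ← sub_eq_zero]
    rw [← h5, sub_eq_iff_eq_add, ← integral_add h7 h6]
    refine integral_congr_ae (ae_of_all _ fun p => ?_)
    simp [inner_sub_right]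

lemma maxInner_mono (hμ : μ ∈ P2 d) (hη : η ∈ P2 d) (hν : ν ∈ P2 d) (h : ConvexOrder η ν) :
    maxInner μ η ≤ maxInner μ ν := by
  obtain ⟨π, hπ, hmax⟩ := exists_innerIntegral_eq_maxInner hμ hη
  obtain ⟨π', hπ', heq⟩ := exists_coupling_of_convexOrder hμ hη hν hπ h
  rw [← hmax, innerIntegral, ← heq (fun x => x) continuous_id ⟨1, fun x => by linarith⟩]
  exact innerIntegral_le_maxInner hμ hν hπ'

end Strassen

section Disintegration

variable {d : ℕ} {μ ν η : Measure (Rd d)} {π : Measure (Rd d × Rd d)}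

lemma compProd_condKernel_of_mem_couplings [IsFiniteMeasure π] (hπ : π ∈ couplings μ ν) :
    μ ⊗ₘ π.condKernel = π := by
  conv_rhs => rw [← π.disintegrate π.condKernel]
  rw [Measure.fst, hπ.1]

lemma integrable_snd (hν : ν ∈ P2 d) (hπ : π.map Prod.snd = ν) :
    Integrable (fun p : Rd d × Rd d => p.2) π := by
  have := integrable_norm_of_mem_P2 hν
  rw [integrable_norm_iff (by fun_prop), ← hπ] at this
  exact this.comp_measurable measurable_snd

lemma integrable_smul_snd (hν : ν ∈ P2 d) (hπ : π.map Prod.snd = ν) {g : Rd d → ℝ}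
    (hg : Continuous g) (hgs : HasCompactSupport g) :
    Integrable (fun p : Rd d × Rd d => g p.1 • p.2) π := by
  obtain ⟨C, hC⟩ := hgs.exists_bound_of_continuous hg
  exact (integrable_snd hν hπ).bdd_smul C (by fun_prop) (ae_of_all _ fun p => hC p.1)

lemma integral_smul_barycenterMap [IsProbabilityMeasure μ] {k : Kernel (Rd d) (Rd d)}
    [IsMarkovKernel k] (hν : ν ∈ P2 d) (hk : (μ ⊗ₘ k).map Prod.snd = ν) {g : Rd d → ℝ}
    (hg : Continuous g) (hgs : HasCompactSupport g) :
    ∫ x, g x • barycenterMap k x ∂μ = ∫ p, g p.1 • p.2 ∂(μ ⊗ₘ k) := by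
  rw [Measure.integral_compProd (integrable_smul_snd hν hk hg hgs)]
  exact integral_congr_ae (ae_of_all _ fun x => (integral_smul _ _).symm)

lemma integrable_barycenterMap [IsProbabilityMeasure μ] {k : Kernel (Rd d) (Rd d)}
    [IsMarkovKernel k] (hν : ν ∈ P2 d) (hk : (μ ⊗ₘ k).map Prod.snd = ν) :
    Integrable (barycenterMap k) μ :=
  (integrable_snd hν hk).integral_compProd

/-- Couplings with the same mixed moments have the same conditional barycentres. -/
lemma map_barycenterMap_eq [IsProbabilityMeasure μ] {k k' : Kernel (Rd d) (Rd d)}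
    [IsMarkovKernel k] [IsMarkovKernel k'] (hη : η ∈ P2 d) (hν : ν ∈ P2 d)
    (hk : (μ ⊗ₘ k).map Prod.snd = η) (hk' : (μ ⊗ₘ k').map Prod.snd = ν)
    (h : ∀ b : Rd d → Rd d, Continuous b → (∃ C, ∀ x, ‖b x‖ ≤ C * (1 + ‖x‖)) →
      ∫ p, inner ℝ (b p.1) p.2 ∂(μ ⊗ₘ k') = ∫ p, inner ℝ (b p.1) p.2 ∂(μ ⊗ₘ k)) :
    μ.map (barycenterMap k') = μ.map (barycenterMap k) := by
  refine Measure.map_congr (ae_eq_of_integral_contDiff_smul_eq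
    (integrable_barycenterMap hν hk').locallyIntegrable
    (integrable_barycenterMap hη hk).locallyIntegrable fun g hg hgs => ?_)
  rw [integral_smul_barycenterMap hν hk' hg.continuous hgs,
    integral_smul_barycenterMap hη hk hg.continuous hgs]
  refine ext_inner_left ℝ fun e => ?_
  rw [← integral_inner (integrable_smul_snd hν hk' hg.continuous hgs),
    ← integral_inner (integrable_smul_snd hη hk hg.continuous hgs)]
  obtain ⟨C, hC⟩ := hgs.exists_bound_of_continuous hg.continuous
  have hC0 : 0 ≤ C := (norm_nonneg _).trans (hC 0)
  have := h (fun x => g x • e) (hg.continuous.smul continuous_const) ⟨C * ‖e‖, fun x => by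
    rw [norm_smul]
    have h1 := mul_le_mul_of_nonneg_right (hC x) (norm_nonneg e)
    have h2 : 0 ≤ C * ‖e‖ * ‖x‖ := by positivity
    linarith⟩
  simpa only [real_inner_smul_left, real_inner_smul_right] using this

end Disintegration

section Mixtures

variable {d : ℕ} {μ ν η₁ η₂ : Measure (Rd d)} {a b : ℝ≥0}

lemma integrable_mixture {X : Type*} [MeasurableSpace X] {μ₁ μ₂ : Measure X} {f : X → ℝ}
    (h₁ : Integrable f μ₁) (h₂ : Integrable f μ₂) (a b : ℝ≥0) :
    Integrable f (a • μ₁ + b • μ₂) :=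
  h₁.smul_measure_nnreal.add_measure h₂.smul_measure_nnreal

lemma integral_mixture {X : Type*} [MeasurableSpace X] {μ₁ μ₂ : Measure X} {f : X → ℝ}
    (h₁ : Integrable f μ₁) (h₂ : Integrable f μ₂) (a b : ℝ≥0) :
    ∫ x, f x ∂(a • μ₁ + b • μ₂) = a * ∫ x, f x ∂μ₁ + b * ∫ x, f x ∂μ₂ := by
  rw [integral_add_measure h₁.smul_measure_nnreal h₂.smul_measure_nnreal,
    integral_smul_nnreal_measure, integral_smul_nnreal_measure]
  rfl

lemma mixture_mem_P2 (h₁ : η₁ ∈ P2 d) (h₂ : η₂ ∈ P2 d) (hab : a + b = 1) :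
    a • η₁ + b • η₂ ∈ P2 d := by
  obtain ⟨_, h1⟩ := mem_P2_iff.1 h₁
  obtain ⟨_, h2⟩ := mem_P2_iff.1 h₂
  refine mem_P2_iff.2 ⟨⟨?_⟩, integrable_mixture h1 h2 a b⟩
  change (a : ℝ≥0∞) * η₁ Set.univ + b * η₂ Set.univ = 1
  rw [measure_univ, measure_univ, mul_one, mul_one]
  exact_mod_cast hab

lemma mixture_convexOrder (h₁ : η₁ ∈ P2 d) (h₂ : η₂ ∈ P2 d) (hν : ν ∈ P2 d) (hab : a + b = 1)
    (hc₁ : ConvexOrder η₁ ν) (hc₂ : ConvexOrder η₂ ν) : ConvexOrder (a • η₁ + b • η₂) ν := by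
  rw [convexOrder_iff (mixture_mem_P2 h₁ h₂ hab) hν]
  intro φ hφ hφν
  obtain ⟨i1, l1⟩ := (convexOrder_iff h₁ hν).1 hc₁ φ hφ hφν
  obtain ⟨i2, l2⟩ := (convexOrder_iff h₂ hν).1 hc₂ φ hφ hφν
  refine ⟨integrable_mixture i1 i2 a b, ?_⟩
  rw [integral_mixture i1 i2]
  have hab' : (a : ℝ) + b = 1 := by exact_mod_cast hab
  calc (a : ℝ) * ∫ x, φ x ∂η₁ + b * ∫ x, φ x ∂η₂
      ≤ a * ∫ x, φ x ∂ν + b * ∫ x, φ x ∂ν := by gcongr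
    _ = ∫ x, φ x ∂ν := by rw [← add_mul, hab', one_mul]

lemma le_maxInner_mixture (hμ : μ ∈ P2 d) (h₁ : η₁ ∈ P2 d) (h₂ : η₂ ∈ P2 d) (hab : a + b = 1) :
    a * maxInner μ η₁ + b * maxInner μ η₂ ≤ maxInner μ (a • η₁ + b • η₂) := by
  obtain ⟨π₁, hπ₁, e₁⟩ := exists_innerIntegral_eq_maxInner hμ h₁
  obtain ⟨π₂, hπ₂, e₂⟩ := exists_innerIntegral_eq_maxInner hμ h₂
  have hπ : a • π₁ + b • π₂ ∈ couplings μ (a • η₁ + b • η₂) := by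
    constructor
    · rw [Measure.map_add _ _ measurable_fst, Measure.map_smul, Measure.map_smul, hπ₁.1, hπ₂.1,
        ← add_smul, hab, one_smul]
    · rw [Measure.map_add _ _ measurable_snd, Measure.map_smul, Measure.map_smul, hπ₁.2, hπ₂.2]
  rw [← e₁, ← e₂, innerIntegral, innerIntegral,
    ← integral_mixture (integrable_of_mem_couplings hμ h₁ hπ₁ inner_mem_quadGrowth)
      (integrable_of_mem_couplings hμ h₂ hπ₂ inner_mem_quadGrowth)]
  exact innerIntegral_le_maxInner hμ (mixture_mem_P2 h₁ h₂ hab) hπ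

lemma convex_setI (hμ : μ ∈ P2 d) (hν : ν ∈ P2 d) : Convex ℝ≥0 (setI μ ν) := by
  intro η₁ h₁ η₂ h₂ a b _ _ hab
  obtain ⟨p₁, c₁, e₁⟩ := (mem_setI_iff hμ hν).1 h₁
  obtain ⟨p₂, c₂, e₂⟩ := (mem_setI_iff hμ hν).1 h₂
  have hP := mixture_mem_P2 p₁ p₂ hab
  have hC := mixture_convexOrder p₁ p₂ hν hab c₁ c₂
  refine (mem_setI_iff hμ hν).2 ⟨hP, hC, le_antisymm (maxInner_mono hμ hP hν hC) ?_⟩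
  have := le_maxInner_mixture hμ p₁ p₂ hab
  have hab' : (a : ℝ) + b = 1 := by exact_mod_cast hab
  rwa [e₁, e₂, ← add_mul, hab', one_mul] at this

end Mixtures

section Main

variable {d : ℕ} {μ ν η : Measure (Rd d)}

lemma mem_setI_of_between (hμ : μ ∈ P2 d) (hν : ν ∈ P2 d) (hη : η ∈ setI μ ν)
    {η' : Measure (Rd d)} [IsProbabilityMeasure η'] (h₁ : ConvexOrder η η')
    (h₂ : ConvexOrder η' ν) : η' ∈ setI μ ν ∧ η ∈ setI μ η' := by
  have hη' := h₂.mem_P2 hν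
  obtain ⟨p, -, e⟩ := (mem_setI_iff hμ hν).1 hη
  have l₁ := maxInner_mono hμ p hη' h₁
  have l₂ := maxInner_mono hμ hη' hν h₂
  exact ⟨(mem_setI_iff hμ hν).2 ⟨hη', h₂, by linarith⟩,
    (mem_setI_iff hμ hη').2 ⟨p, h₁, by linarith⟩⟩

lemma setITilde_subset_setI (hμ : μ ∈ P2 d) (hν : ν ∈ P2 d) : setITilde μ ν ⊆ setI μ ν := by
  rintro _ ⟨k, _, hk, rfl⟩
  obtain ⟨hk, hopt⟩ := (mem_optCouplings_iff hμ hν).1 hk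
  have := hμ.1
  have hP := map_barycenterMap_mem_P2 hk.2 hν
  have hC := convexOrder_map_barycenterMap hk.2 hν
  refine (mem_setI_iff hμ hν).2 ⟨hP, hC, le_antisymm (maxInner_mono hμ hP hν hC) ?_⟩
  have hm := (stronglyMeasurable_barycenterMap (k := k)).measurable
  have hm' : Measurable fun x => (x, barycenterMap k x) := measurable_id.prodMk hm
  have hπ : μ.map (fun x => (x, barycenterMap k x)) ∈ couplings μ (μ.map (barycenterMap k)) := by
    constructor
    · rw [Measure.map_map measurable_fst hm']
      exact Measure.map_id
    · rw [Measure.map_map measurable_snd hm']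
      rfl
  refine le_trans (le_of_eq ?_) (innerIntegral_le_maxInner hμ hP hπ)
  rw [← hopt, innerIntegral, innerIntegral, integral_map hm'.aemeasurable (by fun_prop),
    Measure.integral_compProd (integrable_of_mem_couplings hμ hν hk inner_mem_quadGrowth)]
  refine integral_congr_ae ?_
  filter_upwards [(integrable_snd hν hk.2).ae_of_compProd] with x hx
  exact integral_inner hx x

lemma exists_setITilde_convexOrder (hμ : μ ∈ P2 d) (hν : ν ∈ P2 d) (hη : η ∈ setI μ ν) :
    ∃ θ ∈ setITilde μ ν, ConvexOrder θ η := by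
  obtain ⟨p, c, e⟩ := (mem_setI_iff hμ hν).1 hη
  obtain ⟨π, hπ, hmax⟩ := exists_innerIntegral_eq_maxInner hμ p
  obtain ⟨π', hπ', heq⟩ := exists_coupling_of_convexOrder hμ p hν hπ c
  have := hμ.1
  have := isProbabilityMeasure_of_mem_couplings hμ hπ
  have := isProbabilityMeasure_of_mem_couplings hμ hπ'
  have hd := compProd_condKernel_of_mem_couplings hπ
  have hd' := compProd_condKernel_of_mem_couplings hπ'
  have hopt : innerIntegral π' = maxInner μ ν := by
    rw [← e, ← hmax]
    exact heq (fun x => x) continuous_id ⟨1, fun x => by linarith⟩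
  refine ⟨μ.map (barycenterMap π'.condKernel), ⟨π'.condKernel, inferInstance, ?_, rfl⟩, ?_⟩
  · rw [hd']
    exact (mem_optCouplings_iff hμ hν).2 ⟨hπ', hopt⟩
  · rw [map_barycenterMap_eq (k := π.condKernel) (η := η) (ν := ν) p hν (by rw [hd, hπ.2])
      (by rw [hd', hπ'.2]) (by rwa [hd, hd'])]
    exact convexOrder_map_barycenterMap (by rw [hd, hπ.2]) p

end Main

theorem lemma3 (d : ℕ) (μ ν : Measure (Rd d)) (hμ : μ ∈ P2 d) (hν : ν ∈ P2 d) :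
    (∀ η ∈ setI μ ν, ∀ η' : Measure (Rd d), IsProbabilityMeasure η' →
      ConvexOrder η η' → ConvexOrder η' ν → η' ∈ setI μ ν ∧ η ∈ setI μ η') ∧
    setI μ ν = {η | η ∈ P2 d ∧ ∃ θ ∈ setITilde μ ν, ConvexOrder θ η ∧ ConvexOrder η ν} ∧
    Convex ℝ≥0 (setI μ ν) := by
  refine ⟨fun η hη η' _ h₁ h₂ => mem_setI_of_between hμ hν hη h₁ h₂, Set.ext fun η => ⟨?_, ?_⟩,
    convex_setI hμ hν⟩
  · intro hη
    obtain ⟨θ, hθ, h⟩ := exists_setITilde_convexOrder hμ hν hη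
    exact ⟨hη.1, θ, hθ, h, hη.2.1⟩
  · rintro ⟨hη, θ, hθ, h₁, h₂⟩
    have := hη.1
    exact (mem_setI_of_between hμ hν (setITilde_subset_setI hμ hν hθ) h₁ h₂).1
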